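/- Let $d \ge 2$. Let $\kappa_0(u) = \frac1\pi(\pi - \arccos u)$ and $\kappa_1(u) = \frac1\pi\big(u(\pi - \arccos u) + \sqrt{1-u^2}\big)$ for $u \in [-1,1]$ (the arc-cosine functions of the ReLU activation). Define $\kappa^1(u) = \kappa^1_{\mathrm{NTK}}(u) = u$ and, for $L \ge 2$, $$\kappa^L(u) = \kappa_1(\kappa^{L-1}(u)), \qquad \kappa^L_{\mathrm{NTK}}(u) = \kappa^{L-1}_{\mathrm{NTK}}(u)\,\kappa_0(\kappa^{L-1}(u)) + \kappa^L(u),$$ so that $\kappa^L_{\mathrm{NTK}}$ is the neural tangent kernel function of the $L$-layer fully-connected ReLU network. For $\kappa : [-1,1] \to \mathbb{R}$ and $k \ge 0$ let $$\mu_k(\kappa) = \frac{\omega_{d-2}}{\omega_{d-1}} \int_{-1}^1 \kappa(t) P_k(t) (1-t^2)^{(d-3)/2}\,dt, \qquad \omega_{p-1} = \frac{2\pi^{p/2}}{\Gamma(p/2)},$$ be the eigenvalues of the dot-product kernel $\kappa(x^\top y)$ on the sphere $\mathbb{S}^{d-1}$ with the uniform probability measure, where $P_k$ is the $k$-th Legendre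 polynomial in dimension $d$ (normalized by $P_k(1) = 1$): $P_0 = 1$, $P_1(t) = t$, and $(2k+d-2)\,tP_k = kP_{k-1} + (k+d-2)P_{k+1}$ for $k \ge 1$. Below, $f \sim g$ means that $f$ and $g$ are asymptotically equivalent. 1. (Deep NTK.) For every $L \ge 3$ there are constants $C_{\mathrm{even}}(d,L), C_{\mathrm{odd}}(d,L) > 0$, with $C_{\mathrm{even}}(d,L) \ne C_{\mathrm{odd}}(d,L)$, such that $\mu_k(\kappa^L_{\mathrm{NTK}}) \sim C_{\mathrm{even}}(d,L)\,k^{-d}$ as $k \to \infty$ along even $k$, and $\mu_k(\kappa^L_{\mathrm{NTK}}) \sim C_{\mathrm{odd}}(d,L)\,k^{-d}$ as $k \to \infty$ along odd $k$. Both constants grow quadratically with $L$: there is $K(d) > 0$ such that $C_{\mathrm{even}}(d,L) \sim K(d) L^2$ and $C_{\mathrm{odd}}(d,L) \sim K(d) L^2$ as $L \to \infty$. 2. (Normalized NTK.) For every $L \ge 3$, $\kappa^L_{\mathrm{NTK}}(1)/L = 1$, and the eigenvalues of $\kappa^L_{\mathrm{NTK}}/L$ have the same form of decay: there are positive, distinct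 constants $\tilde C_{\mathrm{even}}(d,L)$, $\tilde C_{\mathrm{odd}}(d,L)$ such that $\mu_k(\kappa^L_{\mathrm{NTK}}/L) \sim \tilde C_{\mathrm{even}}(d,L)\,k^{-d}$ along even $k$ and $\mu_k(\kappa^L_{\mathrm{NTK}}/L) \sim \tilde C_{\mathrm{odd}}(d,L)\,k^{-d}$ along odd $k$. These constants grow linearly with $L$: there is $\tilde K(d) > 0$ such that both are $\sim \tilde K(d) L$ as $L \to \infty$. 3. (Comparison with the two-layer NTK.) The decay is the same as for the two-layer NTK, up to the parity constraint of the latter: there is $C(d) > 0$ such that $\mu_k(\kappa^2_{\mathrm{NTK}}) \sim C(d)\,k^{-d}$ as $k \to \infty$ along even $k$, while $\mu_k(\kappa^2_{\mathrm{NTK}}) = o(k^{-d})$ along odd $k$. -/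

import Mathlib

open Filter Asymptotics
open scoped Topology

noncomputable section

namespace DeepNTK

/-- The arc-cosine function of order zero, `κ₀(u) = (π - arccos u) / π`. -/
def kappa0 (u : ℝ) : ℝ := (Real.pi - Real.arccos u) / Real.pi

/-- The arc-cosine function of order one, `κ₁(u) = (u (π - arccos u) + √(1 - u²)) / π`. -/
def kappa1 (u : ℝ) : ℝ :=
  (u * (Real.pi - Real.arccos u) + Real.sqrt (1 - u ^ 2)) / Real.pi

/-- The random neuron kernel function `κ^L = κ₁ ∘ ⋯ ∘ κ₁` (`L - 1` times) of the `L`-layer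
ReLU network, `L ≥ 1`; in particular `κ¹(u) = u`. -/
def rfKernel (L : ℕ) : ℝ → ℝ := kappa1^[L - 1]

/-- The neural tangent kernel function of the `L`-layer fully-connected ReLU network, `L ≥ 1`:
`κ_NTK¹(u) = u` and `κ_NTK^L(u) = κ_NTK^(L-1)(u) κ₀(κ^(L-1)(u)) + κ^L(u)` for `L ≥ 2`.
The value at `L = 0` is not meaningful. -/
def ntkKernel : ℕ → ℝ → ℝ
  | 0, _ => 0
  | 1, u => u
  | n + 2, u => ntkKernel (n + 1) u * kappa0 (rfKernel (n + 1) u) + rfKernel (n + 2) u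

/-- The Legendre (normalized Gegenbauer) polynomials `P_k` in dimension `d ≥ 2`, with
`P_k(1) = 1`: `P₀ = 1`, `P₁ = t`, and for `k ≥ 1`
`(2k + d - 2) t P_k = k P_(k-1) + (k + d - 2) P_(k+1)`
(in the code, `k` is replaced by `k + 1`). They are orthogonal on `[-1, 1]` for the weight
`(1 - t²)^((d-3)/2)`. -/
def legendreP (d : ℕ) : ℕ → Polynomial ℝ
  | 0 => 1
  | 1 => Polynomial.X
  | k + 2 =>
      Polynomial.C ((2 * (k : ℝ) + d) / ((k : ℝ) + d - 1)) * Polynomial.X * legendreP d (k + 1)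
        - Polynomial.C (((k : ℝ) + 1) / ((k : ℝ) + d - 1)) * legendreP d k

/-- The surface area `2 π^(p/2) / Γ(p/2)` of the unit sphere of `ℝ^p`. -/
def sphereArea (p : ℝ) : ℝ := 2 * Real.pi ^ (p / 2) / Real.Gamma (p / 2)

/-- The `k`-th eigenvalue `μ_k` of the dot-product kernel `(x, y) ↦ κ(⟨x, y⟩)` on the unit sphere
of `ℝ^d` with its uniform probability measure (the one attached to the spherical harmonics of
degree `k`):
`μ_k = (ω_(d-2) / ω_(d-1)) ∫_{-1}^1 κ(t) P_k(t) (1 - t²)^((d-3)/2) dt`,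
where `ω_(p-1)` is the area of the unit sphere of `ℝ^p`. -/
def eigenvalue (d : ℕ) (κ : ℝ → ℝ) (k : ℕ) : ℝ :=
  sphereArea ((d : ℝ) - 1) / sphereArea d *
    ∫ t in (-1 : ℝ)..1, κ t * (legendreP d k).eval t * (1 - t ^ 2) ^ (((d : ℝ) - 3) / 2)

end DeepNTK

end

/-! Put `t = cos θ`. Up to a positive factor depending on `d`, the eigenvalue is the Legendre
coefficient of `F θ = κ (cos θ)` for the weight `sin θ ^ (d - 2)`. The square-root singularities of
the arc-cosine functions at `t = ±1` disappear in the angle: every NTK becomes real analytic on the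
closed interval `[0, π]`, poles included.

For such an `F`, what stops fast decay is that `F` need not be smooth on the sphere at the two
poles, and the leading defect there is measured by `F' 0` and `F' π`. Subtracting suitable multiples
of `sin (θ / 2)` and `cos (θ / 2)` removes both derivatives. The Laplace–Beltrami operator then maps
the difference to another analytic function and divides its coefficients by `k (k + d - 2)`; since
analytic functions have coefficients `O(k^(-d))`, the remainder is `o(k^(-d))`. The coefficients of
`sin (θ / 2)` satisfy an exact first-order recurrence and are asymptotic to `-c k^(-d)`; reflection
gives those of `cos (θ / 2)` with a factor `(-1)^k`. Hence, after doubling `c`, the limits are `c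
(-F' 0 ± F' π)` (`exists_tendsto_polarCoeff`).

It remains to find the two derivatives. In the angle, `κ₁` acts as an analytic map `polarMap` with
derivative `1` at its fixed point `0` and derivative `0` at `π`. With `L = n + 1`, the NTK recursion
gives `F' 0 = -n (n + 1) / (2 π)` and, for `n ≥ 1`, `0 < F' π ≤ 1 / π`, with `F' π = 1 / π` when `n
= 1`. Thus the pole `0` carries the quadratic growth, the pole `π` separates the parities, and for
`L = 2` they cancel exactly along odd `k`. -/

namespace DeepNTK

/-! ### Legendre polynomials: recurrences, differential equation, uniform bound -/

section Legendre

open Polynomial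

theorem legendreP_rec {d : ℕ} (hd : 2 ≤ d) (k : ℕ) :
    ((k : ℝ[X]) + (d : ℝ[X]) - 1) * legendreP d (k + 2) =
      (2 * (k : ℝ[X]) + (d : ℝ[X])) * X * legendreP d (k + 1) -
        ((k : ℝ[X]) + 1) * legendreP d k := by
  have h2 : (2 : ℝ) ≤ d := by exact_mod_cast hd
  have h0 : ((k : ℝ) + d - 1) ≠ 0 := by
    have : (0 : ℝ) ≤ k := k.cast_nonneg
    linarith
  have e (a : ℝ) : ((k : ℝ[X]) + (d : ℝ[X]) - 1) * C (a / ((k : ℝ) + d - 1)) = C a := by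
    have : ((k : ℝ[X]) + (d : ℝ[X]) - 1) = C ((k : ℝ) + d - 1) := by simp
    rw [this, ← C_mul]
    congr 1
    field_simp
  have e1 := e (2 * (k : ℝ) + d)
  have e2 := e ((k : ℝ) + 1)
  simp only [map_add, map_mul, map_natCast, map_ofNat, map_one] at e1 e2
  rw [legendreP]
  linear_combination X * legendreP d (k + 1) * e1 - legendreP d k * e2

/-- The two identities go through one induction: differentiating the three-term recurrence gives the
first from both earlier ones, and the second follows from the earlier first and the recurrence. -/
theorem legendreP_derivative {d : ℕ} (hd : 2 ≤ d) (k : ℕ) :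
    (1 - X ^ 2) * derivative (legendreP d (k + 1)) =
        ((k : ℝ[X]) + 1) * (legendreP d k - X * legendreP d (k + 1)) ∧
      (1 - X ^ 2) * derivative (legendreP d k) =
        ((k : ℝ[X]) + (d : ℝ[X]) - 2) * (X * legendreP d k - legendreP d (k + 1)) := by
  induction k with
  | zero => simp [legendreP, pow_two]
  | succ k ih =>
    obtain ⟨hA, hB⟩ := ih
    have hr := legendreP_rec hd k
    have hr' := congrArg derivative hr
    have h2 : (2 : ℝ) ≤ d := by exact_mod_cast hd
    have h0 : ((k : ℝ[X]) + (d : ℝ[X]) - 1) ≠ 0 := by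
      have h1 : ((k : ℝ) + d - 1) ≠ 0 := by
        have : (0 : ℝ) ≤ k := k.cast_nonneg
        linarith
      have : ((k : ℝ[X]) + (d : ℝ[X]) - 1) = C ((k : ℝ) + d - 1) := by simp
      rw [this]
      exact C_ne_zero.2 h1
    simp only [derivative_mul, derivative_add, derivative_sub, derivative_natCast, derivative_one,
      derivative_X, derivative_ofNat] at hr'
    push_cast
    refine ⟨mul_left_cancel₀ h0 ?_, ?_⟩
    · linear_combination (1 - X ^ 2) * hr' + (2 * (k : ℝ[X]) + (d : ℝ[X])) * X * hA
        - ((k : ℝ[X]) + 1) * hB + ((k : ℝ[X]) + 2) * X * hr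
    · linear_combination hA + hr

/-- Differentiate the first identity of `legendreP_derivative`, eliminate the neighbouring
polynomial by means of both identities, and cancel `1 - X ^ 2`. -/
theorem legendreP_ode {d : ℕ} (hd : 2 ≤ d) (k : ℕ) :
    (1 - X ^ 2) * derivative (derivative (legendreP d k))
      - ((d : ℝ[X]) - 1) * X * derivative (legendreP d k)
      + (k : ℝ[X]) * ((k : ℝ[X]) + (d : ℝ[X]) - 2) * legendreP d k = 0 := by
  cases k with
  | zero => simp [legendreP]
  | succ n =>
    obtain ⟨hA, -⟩ := legendreP_derivative hd n
    obtain ⟨-, hB⟩ := legendreP_derivative hd n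
    have hA' := congrArg derivative hA
    have h0 : (1 - X ^ 2 : ℝ[X]) ≠ 0 := by
      intro h
      have := congrArg (eval 0) h
      simp at this
    simp only [derivative_mul, derivative_add, derivative_sub, derivative_natCast, derivative_one,
      derivative_X, derivative_pow] at hA'
    push_cast
    refine mul_left_cancel₀ h0 ?_
    simp at hA'
    rw [show (C (2 : ℝ) : ℝ[X]) = 2 from rfl] at hA'
    linear_combination (1 - X ^ 2) * hA' + ((n : ℝ[X]) + 1) * hB -
      ((n : ℝ[X]) + (d : ℝ[X]) - 2) * X * hA

theorem legendreP_eval_one {d : ℕ} (hd : 2 ≤ d) (k : ℕ) : (legendreP d k).eval 1 = 1 := by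
  have h2 : (2 : ℝ) ≤ d := by exact_mod_cast hd
  have key : (legendreP d k).eval 1 = 1 ∧ (legendreP d (k + 1)).eval 1 = 1 := by
    induction k with
    | zero => simp [legendreP]
    | succ k ih =>
      refine ⟨ih.2, ?_⟩
      have h := congrArg (eval 1) (legendreP_rec hd k)
      simp [ih.1, ih.2] at h
      have : (0 : ℝ) ≤ k := k.cast_nonneg
      refine mul_left_cancel₀ (a := (k : ℝ) + d - 1) (by linarith) ?_
      linarith
  exact key.1

theorem legendreP_eval_neg {d : ℕ} (hd : 2 ≤ d) (k : ℕ) (t : ℝ) :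
    (legendreP d k).eval (-t) = (-1) ^ k * (legendreP d k).eval t := by
  have h2 : (2 : ℝ) ≤ d := by exact_mod_cast hd
  have key : (legendreP d k).eval (-t) = (-1) ^ k * (legendreP d k).eval t ∧
      (legendreP d (k + 1)).eval (-t) = (-1) ^ (k + 1) * (legendreP d (k + 1)).eval t := by
    induction k with
    | zero => simp [legendreP]
    | succ k ih =>
      refine ⟨ih.2, ?_⟩
      have h := congrArg (eval (-t)) (legendreP_rec hd k)
      have h' := congrArg (eval t) (legendreP_rec hd k)
      simp [ih.1, ih.2] at h h'
      have : (0 : ℝ) ≤ k := k.cast_nonneg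
      refine mul_left_cancel₀ (a := (k : ℝ) + d - 1) (by linarith) ?_
      linear_combination h - (-1) ^ k * h'
  exact key.1

theorem abs_legendreP_le_one {d : ℕ} (hd : 2 ≤ d) (k : ℕ) {t : ℝ} (ht : t ∈ Set.Icc (-1 : ℝ) 1) :
    |(legendreP d k).eval t| ≤ 1 := by
  have h2 : (2 : ℝ) ≤ d := by exact_mod_cast hd
  rcases Nat.eq_zero_or_pos k with rfl | hk
  · simp [legendreP]
  have hk' : (1 : ℝ) ≤ k := by exact_mod_cast hk
  set lam : ℝ := k * (k + d - 2) with hlam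
  have hlam0 : 0 < lam := by
    apply mul_pos <;> linarith
  -- Sonin's function: it dominates `lam * P ^ 2` on `[-1, 1]`, equals `lam` at `1`, and by the
  -- differential equation its derivative is nonnegative on `[0, 1]` because `d ≥ 2`.
  set Q : ℝ[X] := C lam * legendreP d k ^ 2 + (1 - X ^ 2) * derivative (legendreP d k) ^ 2 with hQ
  have hQ' : derivative Q = 2 * ((d : ℝ[X]) - 2) * X * derivative (legendreP d k) ^ 2 := by
    have ho := legendreP_ode hd k
    have hl : (C lam : ℝ[X]) = (k : ℝ[X]) * ((k : ℝ[X]) + (d : ℝ[X]) - 2) := by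
      simp only [hlam, map_mul, map_add, map_sub, map_natCast]
      rfl
    rw [hQ, hl]
    simp only [derivative_mul, derivative_add, derivative_sub, derivative_natCast, derivative_one,
      derivative_X, derivative_pow, derivative_ofNat, map_natCast]
    push_cast
    simp only [pow_one, zero_mul, zero_add, zero_sub, mul_one]
    linear_combination 2 * derivative (legendreP d k) * ho
  have hmono : MonotoneOn (fun x => Q.eval x) (Set.Icc 0 1) := by
    refine monotoneOn_of_deriv_nonneg (convex_Icc _ _) Q.continuousOn
      Q.differentiable.differentiableOn fun x hx => ?_
    rw [interior_Icc] at hx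
    rw [Polynomial.deriv, hQ']
    simp only [eval_mul, eval_sub, eval_natCast, eval_ofNat, eval_X, eval_pow]
    have := hx.1
    have : (0 : ℝ) ≤ d - 2 := by linarith
    positivity
  have main : ∀ x ∈ Set.Icc (0 : ℝ) 1, |(legendreP d k).eval x| ≤ 1 := by
    intro x hx
    have h := hmono hx (Set.right_mem_Icc.2 zero_le_one) hx.2
    simp only [hQ, eval_add, eval_mul, eval_C, eval_pow, eval_sub, eval_one, eval_X,
      legendreP_eval_one hd] at h
    have hx2 : 0 ≤ (1 - x ^ 2) * (derivative (legendreP d k)).eval x ^ 2 := by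
      have : 0 ≤ 1 - x ^ 2 := by nlinarith [hx.1, hx.2]
      positivity
    rw [← sq_le_one_iff_abs_le_one]
    refine le_of_mul_le_mul_left ?_ hlam0
    linarith
  rcases le_total 0 t with h | h
  · exact main t ⟨h, ht.2⟩
  · have := main (-t) ⟨by linarith, by linarith [ht.1]⟩
    rwa [legendreP_eval_neg hd, abs_mul, abs_pow, abs_neg, abs_one, one_pow, one_mul] at this

end Legendre

/-! ### Legendre coefficients in the polar angle -/

open Real Set

/-- The Legendre coefficient `∫₀^π F(θ) P_k(cos θ) sin(θ)^(d-2) dθ` in polar coordinates. -/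
noncomputable def polarCoeff (d : ℕ) (F : ℝ → ℝ) (k : ℕ) : ℝ :=
  ∫ θ in (0 : ℝ)..π, F θ * (legendreP d k).eval (cos θ) * sin θ ^ (d - 2)

theorem eigenvalue_eq_polarCoeff {d : ℕ} (hd : 2 ≤ d) (κ : ℝ → ℝ) (k : ℕ) :
    eigenvalue d κ k =
      sphereArea ((d : ℝ) - 1) / sphereArea d * polarCoeff d (fun θ => κ (cos θ)) k := by
  obtain ⟨n, rfl⟩ := Nat.exists_eq_add_of_le' hd
  unfold eigenvalue polarCoeff
  congr 1
  have himg : cos '' Ioo 0 π = Ioo (-1) 1 := by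
    apply Subset.antisymm
    · rintro _ ⟨θ, hθ, rfl⟩
      constructor
      · rw [← cos_pi]
        exact cos_lt_cos_of_nonneg_of_le_pi hθ.1.le le_rfl hθ.2
      · rw [← cos_zero]
        exact cos_lt_cos_of_nonneg_of_le_pi le_rfl hθ.2.le hθ.1
    · intro t ht
      exact ⟨arccos t, ⟨arccos_pos.2 ht.2, arccos_lt_pi.2 ht.1⟩, cos_arccos ht.1.le ht.2.le⟩
  rw [intervalIntegral.integral_of_le (by norm_num), intervalIntegral.integral_of_le pi_pos.le,
    MeasureTheory.integral_Ioc_eq_integral_Ioo, MeasureTheory.integral_Ioc_eq_integral_Ioo, ← himg,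
    MeasureTheory.integral_image_eq_integral_abs_deriv_smul measurableSet_Ioo
      (fun x _ => (hasDerivAt_cos x).hasDerivWithinAt) (injOn_cos.mono Ioo_subset_Icc_self)]
  refine MeasureTheory.setIntegral_congr_fun measurableSet_Ioo fun θ hθ => ?_
  have hs : 0 < sin θ := sin_pos_of_pos_of_lt_pi hθ.1 hθ.2
  simp only [smul_eq_mul, abs_neg, abs_of_pos hs]
  -- The exponent is `-1` on the right when `d = 2`, so a real power of the positive `sin θ` is
  -- needed; the Jacobian supplies the missing factor.
  have h1 : (1 - cos θ ^ 2) ^ ((((n + 2 : ℕ) : ℝ) - 3) / 2) = sin θ ^ (((n : ℝ) - 1)) := by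
    rw [← sin_sq, ← rpow_natCast, ← rpow_mul hs.le]
    congr 1
    push_cast
    ring
  have h2 : sin θ ^ ((n : ℝ) - 1) * sin θ = sin θ ^ n := by
    rw [← rpow_add_one hs.ne', sub_add_cancel, rpow_natCast]
  rw [h1, Nat.add_sub_cancel, ← h2]
  ring

/-! ### The coefficients of `sin (θ / 2)` -/

/-- An integration by parts (`hA`) and the three-term recurrence (`hR`) both involve the auxiliary
integrals `T` with an extra `cos θ`; eliminating `T` closes the induction. -/
theorem polarCoeff_sin_half_succ {d : ℕ} (hd : 2 ≤ d) (k : ℕ) :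
    ((k : ℝ) + d - 1 / 2) * polarCoeff d (fun θ => sin (θ / 2)) (k + 1) =
      ((k : ℝ) - 1 / 2) * polarCoeff d (fun θ => sin (θ / 2)) k := by
  obtain ⟨n, rfl⟩ := Nat.exists_eq_add_of_le' hd
  set J := polarCoeff (n + 2) (fun θ => sin (θ / 2)) with hJ
  set T : ℕ → ℝ := fun k =>
    ∫ θ in (0 : ℝ)..π, sin (θ / 2) * cos θ * (legendreP (n + 2) k).eval (cos θ) * sin θ ^ n with hT
  have hJ' (k : ℕ) :
      J k = ∫ θ in (0 : ℝ)..π, sin (θ / 2) * (legendreP (n + 2) k).eval (cos θ) * sin θ ^ n := rfl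
  have hp (k : ℕ) : Continuous fun θ => (legendreP (n + 2) k).eval (cos θ) :=
    (legendreP (n + 2) k).continuous.comp continuous_cos
  have iJ (k : ℕ) : IntervalIntegrable
      (fun θ => sin (θ / 2) * (legendreP (n + 2) k).eval (cos θ) * sin θ ^ n)
      MeasureTheory.volume 0 π := by
    have := hp k
    exact Continuous.intervalIntegrable (by fun_prop) _ _
  have iT (k : ℕ) : IntervalIntegrable
      (fun θ => sin (θ / 2) * cos θ * (legendreP (n + 2) k).eval (cos θ) * sin θ ^ n)
      MeasureTheory.volume 0 π := by
    have := hp k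
    exact Continuous.intervalIntegrable (by fun_prop) _ _
  have hA (k : ℕ) : ((k : ℝ) + n) * J (k + 1) = ((k : ℝ) - 3 / 2) * T k - 1 / 2 * J k := by
    have hI : ∫ θ in (0 : ℝ)..π,
        (1 / 2 * (sin (θ / 2) * (legendreP (n + 2) k).eval (cos θ) * sin θ ^ n) +
          (3 / 2 - k) *
            (sin (θ / 2) * cos θ * (legendreP (n + 2) k).eval (cos θ) * sin θ ^ n) +
          (k + n) * (sin (θ / 2) * (legendreP (n + 2) (k + 1)).eval (cos θ) * sin θ ^ n)) =
        sin (π / 2) * sin π ^ (n + 1) * (legendreP (n + 2) k).eval (cos π) -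
          sin (0 / 2) * sin 0 ^ (n + 1) * (legendreP (n + 2) k).eval (cos 0) := by
      refine intervalIntegral.integral_eq_sub_of_hasDerivAt
        (f := fun θ => sin (θ / 2) * sin θ ^ (n + 1) * (legendreP (n + 2) k).eval (cos θ))
        (fun θ _ => ?_) ?_
      · have h1 : HasDerivAt (fun θ => sin (θ / 2)) (cos (θ / 2) * (1 / 2)) θ :=
          ((hasDerivAt_id θ).div_const 2).sin
        have h2 := (hasDerivAt_sin θ).pow (n + 1)
        have h3 := ((legendreP (n + 2) k).hasDerivAt (cos θ)).comp θ (hasDerivAt_cos θ)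
        refine ((h1.mul h2).mul h3).congr_deriv ?_
        have hB := congrArg (Polynomial.eval (cos θ)) (legendreP_derivative hd k).2
        simp at hB
        rw [← sin_sq] at hB
        have hs : sin θ = 2 * sin (θ / 2) * cos (θ / 2) := by
          rw [← sin_two_mul, mul_div_cancel₀ _ two_ne_zero]
        have hc : 1 + cos θ = 2 * cos (θ / 2) ^ 2 := by
          have := cos_sq (θ / 2)
          rw [mul_div_cancel₀ _ two_ne_zero] at this
          linarith
        simp only [Pi.mul_apply, Pi.pow_apply, Function.comp_apply, Nat.add_sub_cancel]
        push_cast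
        -- This identity turns the derivative of `sin (θ / 2)` back into `sin (θ / 2)`, so that no
        -- other integrals appear.
        have hs' : cos (θ / 2) * sin θ = sin (θ / 2) * (1 + cos θ) := by
          rw [hs, hc]
          ring
        linear_combination -(sin (θ / 2) * sin θ ^ n) * hB +
          1 / 2 * (legendreP (n + 2) k).eval (cos θ) * sin θ ^ n * hs'
      · exact (((iJ k).const_mul _).add ((iT k).const_mul _)).add ((iJ (k + 1)).const_mul _)
    rw [intervalIntegral.integral_add (((iJ k).const_mul _).add ((iT k).const_mul _))
      ((iJ (k + 1)).const_mul _), intervalIntegral.integral_add ((iJ k).const_mul _)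
      ((iT k).const_mul _), intervalIntegral.integral_const_mul,
      intervalIntegral.integral_const_mul, intervalIntegral.integral_const_mul, ← hJ', ← hJ',
      sin_pi, sin_zero, zero_pow (Nat.succ_ne_zero n)] at hI
    simp only [mul_zero, zero_mul, sub_zero] at hI
    linear_combination hI
  have hR (k : ℕ) : (2 * (k : ℝ) + n + 2) * T (k + 1) =
      ((k : ℝ) + 1) * J k + ((k : ℝ) + n + 1) * J (k + 2) := by
    rw [hJ', hJ', hT, ← intervalIntegral.integral_const_mul, ← intervalIntegral.integral_const_mul,
      ← intervalIntegral.integral_const_mul,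
      ← intervalIntegral.integral_add ((iJ k).const_mul _) ((iJ (k + 2)).const_mul _)]
    refine intervalIntegral.integral_congr fun θ _ => ?_
    have h := congrArg (Polynomial.eval (cos θ)) (legendreP_rec hd k)
    simp at h
    linear_combination -(sin (θ / 2) * sin θ ^ n) * h
  push_cast
  induction k with
  | zero =>
    have h0 : T 0 = J 1 := by
      rw [hJ', hT]
      refine intervalIntegral.integral_congr fun θ _ => ?_
      simp [legendreP]
    have := hA 0
    rw [h0] at this
    push_cast at this ⊢
    linear_combination this
  | succ k ih =>
    have h1 := hA (k + 1)
    have h2 := hR k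
    push_cast at h1 ⊢
    have h0 : (k : ℝ) + 1 + n ≠ 0 := by positivity
    refine mul_left_cancel₀ h0 ?_
    linear_combination (2 * (k : ℝ) + n + 2) * h1 + ((k : ℝ) - 1 / 2) * h2 - ((k : ℝ) + 1) * ih

theorem polarCoeff_sin_half_mul_prod {d : ℕ} (hd : 2 ≤ d) (k : ℕ) :
    polarCoeff d (fun θ => sin (θ / 2)) k * ∏ i ∈ Finset.range d, ((k : ℝ) - 1 / 2 + i) =
      polarCoeff d (fun θ => sin (θ / 2)) 0 * ∏ i ∈ Finset.range d, ((i : ℝ) - 1 / 2) := by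
  induction k with
  | zero => simp [neg_add_eq_sub]
  | succ k ih =>
    rw [← ih]
    have h := polarCoeff_sin_half_succ hd k
    have hk : (k : ℝ) - 1 / 2 ≠ 0 := by
      intro h
      have h2 : (2 * k : ℝ) = 1 := by linarith
      have : 2 * k = 1 := by exact_mod_cast h2
      omega
    have hprod : (∏ i ∈ Finset.range d, (((k + 1 : ℕ) : ℝ) - 1 / 2 + i)) * ((k : ℝ) - 1 / 2) =
        (∏ i ∈ Finset.range d, ((k : ℝ) - 1 / 2 + i)) * ((k : ℝ) - 1 / 2 + d) := by
      rw [← Finset.prod_range_succ, Finset.prod_range_succ']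
      congr 1
      · refine Finset.prod_congr rfl fun i _ => ?_
        push_cast
        ring
      · simp
    refine mul_right_cancel₀ hk ?_
    rw [mul_assoc, hprod]
    linear_combination (∏ i ∈ Finset.range d, ((k : ℝ) - 1 / 2 + i)) * h

theorem tendsto_polarCoeff_sin_half {d : ℕ} (hd : 2 ≤ d) :
    ∃ c : ℝ, 0 < c ∧ Tendsto (fun k : ℕ => (k : ℝ) ^ d * polarCoeff d (fun θ => sin (θ / 2)) k)
      atTop (𝓝 (-c)) := by
  refine ⟨-(polarCoeff d (fun θ => sin (θ / 2)) 0 * ∏ i ∈ Finset.range d, ((i : ℝ) - 1 / 2)),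
    ?_, ?_⟩
  · have h0 : 0 < polarCoeff d (fun θ => sin (θ / 2)) 0 := by
      unfold polarCoeff
      refine intervalIntegral.intervalIntegral_pos_of_pos_on ?_ (fun θ hθ => ?_) pi_pos
      · have : Continuous fun θ => (legendreP d 0).eval (cos θ) :=
          (legendreP d 0).continuous.comp continuous_cos
        exact Continuous.intervalIntegrable (by fun_prop) _ _
      · have h1 : 0 < sin θ := sin_pos_of_pos_of_lt_pi hθ.1 hθ.2
        have h2 : 0 < sin (θ / 2) :=
          sin_pos_of_pos_of_lt_pi (by linarith [hθ.1]) (by linarith [hθ.1, hθ.2])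
        simp only [legendreP, Polynomial.eval_one]
        positivity
    obtain ⟨n, rfl⟩ := Nat.exists_eq_add_of_le' hd
    have h1 : 0 < ∏ i ∈ Finset.range (n + 1), (((i + 1 : ℕ) : ℝ) - 1 / 2) :=
      Finset.prod_pos fun i _ => by
        have : (0 : ℝ) ≤ i := i.cast_nonneg
        push_cast
        linarith
    -- The factor `i = 0`, equal to `-1 / 2`, is the only negative one: this fixes the sign of the
    -- limit.
    rw [Finset.prod_range_succ']
    have := mul_pos h0 h1
    push_cast at this ⊢
    linarith
  · rw [neg_neg]
    have hlim : Tendsto (fun k : ℕ => ∏ i ∈ Finset.range d, (1 + ((i : ℝ) - 1 / 2) / k)) atTop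
        (𝓝 (∏ i ∈ Finset.range d, (1 : ℝ))) := by
      refine tendsto_finsetProd _ fun i _ => ?_
      simpa using (tendsto_const_div_atTop_nhds_zero_nat ((i : ℝ) - 1 / 2)).const_add 1
    rw [Finset.prod_const_one] at hlim
    have h := (tendsto_const_nhds (x := polarCoeff d (fun θ => sin (θ / 2)) 0 *
      ∏ i ∈ Finset.range d, ((i : ℝ) - 1 / 2))).div hlim one_ne_zero
    rw [div_one] at h
    refine h.congr' ?_
    filter_upwards [eventually_ge_atTop 1] with k hk
    have hk' : (1 : ℝ) ≤ k := by exact_mod_cast hk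
    have hpos : 0 < ∏ i ∈ Finset.range d, ((k : ℝ) - 1 / 2 + i) :=
      Finset.prod_pos fun i _ => by
        have : (0 : ℝ) ≤ i := i.cast_nonneg
        linarith
    have hfac : (∏ i ∈ Finset.range d, (1 + ((i : ℝ) - 1 / 2) / k)) * (k : ℝ) ^ d =
        ∏ i ∈ Finset.range d, ((k : ℝ) - 1 / 2 + i) := by
      conv_lhs => rw [← Finset.card_range d, ← Finset.prod_const, Finset.card_range]
      rw [← Finset.prod_mul_distrib]
      refine Finset.prod_congr rfl fun i _ => ?_
      field_simp
      ring
    have hne : (∏ i ∈ Finset.range d, (1 + ((i : ℝ) - 1 / 2) / k)) ≠ 0 := by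
      intro h0
      rw [h0, zero_mul] at hfac
      exact hpos.ne hfac
    rw [Pi.div_apply, div_eq_iff hne, ← polarCoeff_sin_half_mul_prod hd k, ← hfac]
    ring

theorem polarCoeff_cos_half {d : ℕ} (hd : 2 ≤ d) (k : ℕ) :
    polarCoeff d (fun θ => cos (θ / 2)) k =
      (-1) ^ k * polarCoeff d (fun θ => sin (θ / 2)) k := by
  unfold polarCoeff
  rw [← intervalIntegral.integral_const_mul]
  have h := intervalIntegral.integral_comp_sub_left (a := 0) (b := π)
    (fun θ => cos (θ / 2) * (legendreP d k).eval (cos θ) * sin θ ^ (d - 2)) π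
  rw [sub_self, sub_zero] at h
  rw [← h]
  refine intervalIntegral.integral_congr fun θ _ => ?_
  simp only [cos_pi_sub, sin_pi_sub, legendreP_eval_neg hd, sub_div, cos_pi_div_two_sub]
  ring

/-! ### Reduction by the Laplace–Beltrami operator -/

/-- Green's identity for the Laplace–Beltrami operator `F'' + (d - 2) cot θ F'`. Writing `F' = g sin
θ` cancels the cotangent, and the boundary terms vanish with `sin`. -/
theorem polarCoeff_eq_of_hasDerivAt {d : ℕ} (hd : 2 ≤ d) (k : ℕ) {F g g' : ℝ → ℝ}
    (hF : ∀ θ ∈ Icc 0 π, HasDerivAt F (g θ * sin θ) θ)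
    (hg : ∀ θ ∈ Icc 0 π, HasDerivAt g (g' θ) θ) (hg' : ContinuousOn g' (Icc 0 π)) :
    (k : ℝ) * (k + d - 2) * polarCoeff d F k =
      -polarCoeff d (fun θ => g' θ * sin θ + ((d : ℝ) - 1) * (g θ * cos θ)) k := by
  obtain ⟨n, rfl⟩ := Nat.exists_eq_add_of_le' hd
  have hu : uIcc 0 π = Icc 0 π := uIcc_of_le pi_pos.le
  have cF : ContinuousOn F (Icc 0 π) := fun θ hθ => (hF θ hθ).continuousAt.continuousWithinAt
  have cg : ContinuousOn g (Icc 0 π) := fun θ hθ => (hg θ hθ).continuousAt.continuousWithinAt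
  have cp : Continuous fun θ => (legendreP (n + 2) k).eval (cos θ) :=
    (legendreP (n + 2) k).continuous.comp continuous_cos
  set A : ℝ → ℝ := fun θ => F θ * (legendreP (n + 2) k).eval (cos θ) * sin θ ^ n with hA
  set B : ℝ → ℝ := fun θ => (g' θ * sin θ + (((n + 2 : ℕ) : ℝ) - 1) * (g θ * cos θ)) *
    (legendreP (n + 2) k).eval (cos θ) * sin θ ^ n with hB
  have iA : IntervalIntegrable A MeasureTheory.volume 0 π := by
    apply ContinuousOn.intervalIntegrable
    rw [hu, hA]
    fun_prop
  have iB : IntervalIntegrable B MeasureTheory.volume 0 π := by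
    apply ContinuousOn.intervalIntegrable
    rw [hu, hB]
    fun_prop
  have hI : ∫ θ in (0 : ℝ)..π, ((k : ℝ) * (k + ((n + 2 : ℕ) : ℝ) - 2) * A θ + B θ) = 0 := by
    rw [intervalIntegral.integral_eq_sub_of_hasDerivAt
      (f := fun θ => sin θ ^ (n + 1) *
        (F θ * (Polynomial.derivative (legendreP (n + 2) k)).eval (cos θ) +
          g θ * (legendreP (n + 2) k).eval (cos θ))) (fun θ hθ => ?_) ((iA.const_mul _).add iB)]
    · simp
    · rw [hu] at hθ
      have h2 := (hasDerivAt_sin θ).pow (n + 1)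
      have h3 := ((legendreP (n + 2) k).hasDerivAt (cos θ)).comp θ (hasDerivAt_cos θ)
      have h4 := ((Polynomial.derivative (legendreP (n + 2) k)).hasDerivAt (cos θ)).comp θ
        (hasDerivAt_cos θ)
      refine (h2.mul (((hF θ hθ).mul h4).add ((hg θ hθ).mul h3))).congr_deriv ?_
      have ho := congrArg (Polynomial.eval (cos θ)) (legendreP_ode hd k)
      simp at ho
      rw [← sin_sq] at ho
      simp only [hA, hB, Pi.mul_apply, Pi.add_apply, Pi.pow_apply, Function.comp_apply,
        Nat.add_sub_cancel]
      push_cast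
      linear_combination -(F θ * sin θ ^ n) * ho
  rw [intervalIntegral.integral_add (iA.const_mul _) iB, intervalIntegral.integral_const_mul] at hI
  exact eq_neg_of_add_eq_zero_left hI

theorem abs_polarCoeff_le {d : ℕ} (hd : 2 ≤ d) {F : ℝ → ℝ} (hF : ContinuousOn F (Icc 0 π)) :
    ∃ M : ℝ, ∀ k, |polarCoeff d F k| ≤ M := by
  obtain ⟨M, hM⟩ := isCompact_Icc.exists_bound_of_continuousOn hF
  refine ⟨M * |π - 0|, fun k => ?_⟩
  rw [← norm_eq_abs, polarCoeff]
  refine intervalIntegral.norm_integral_le_of_norm_le_const fun θ hθ => ?_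
  rw [uIoc_of_le pi_pos.le] at hθ
  have hm := hM θ (Ioc_subset_Icc_self hθ)
  have h1 := abs_legendreP_le_one hd k (cos_mem_Icc θ)
  have h2 : |sin θ| ^ (d - 2) ≤ 1 := pow_le_one₀ (abs_nonneg _) (abs_sin_le_one θ)
  rw [norm_mul, norm_mul, norm_pow, norm_eq_abs (sin θ), norm_eq_abs (Polynomial.eval _ _)]
  have h0 : 0 ≤ ‖F θ‖ := norm_nonneg _
  calc ‖F θ‖ * |(legendreP d k).eval (cos θ)| * |sin θ| ^ (d - 2) ≤ ‖F θ‖ * 1 * 1 := by gcongr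
    _ ≤ M := by simpa using hm

theorem analyticAt_dslope_self {f : ℝ → ℝ} {a : ℝ} (hf : AnalyticAt ℝ f a) :
    AnalyticAt ℝ (dslope f a) a := by
  obtain ⟨p, hp⟩ := hf
  exact ⟨_, hp.has_fpower_series_dslope_fslope⟩

/-- An analytic function vanishing at both ends of `[0, π]` is an analytic multiple of `sin`. -/
theorem exists_analyticOnNhd_mul_sin {f : ℝ → ℝ} (hf : AnalyticOnNhd ℝ f (Icc 0 π))
    (h0 : f 0 = 0) (hπ : f π = 0) :
    ∃ g, AnalyticOnNhd ℝ g (Icc 0 π) ∧ ∀ θ ∈ Icc 0 π, f θ = g θ * sin θ := by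
  have hends : ∀ θ ∈ Icc 0 π, sin θ = 0 → f θ = 0 := by
    intro θ hθ hs
    rcases hθ.1.eq_or_lt with h | h
    · rwa [← h]
    rcases hθ.2.eq_or_lt with h' | h'
    · rwa [h']
    exact absurd hs (sin_pos_of_pos_of_lt_pi h h').ne'
  -- At a zero of `sin` the value is the l'Hôpital limit; near it the quotient agrees with the
  -- quotient of the two `dslope`s, which are analytic.
  refine ⟨fun θ => if sin θ = 0 then deriv f θ / cos θ else f θ / sin θ, fun a ha => ?_,
    fun θ hθ => ?_⟩
  · by_cases hs : sin a = 0
    · have hds : dslope sin a a = cos a := by rw [dslope_same, Real.deriv_sin]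
      have hc : cos a ≠ 0 := by
        intro hc
        have := sin_sq_add_cos_sq a
        simp [hs, hc] at this
      have h1 := analyticAt_dslope_self (hf a ha)
      have h2 := analyticAt_dslope_self (analyticAt_sin (x := a))
      have hne : dslope sin a a ≠ 0 := by rwa [hds]
      refine (h1.div h2 hne).congr ?_
      filter_upwards [h2.continuousAt.eventually_ne hne] with θ hθ
      rcases eq_or_ne θ a with rfl | hne'
      · simp [hs]
      · have e1 : dslope sin a θ = (θ - a)⁻¹ * sin θ := by
          rw [dslope_of_ne _ hne', slope_def_module, hs, sub_zero, smul_eq_mul]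
        have e2 : dslope f a θ = (θ - a)⁻¹ * f θ := by
          rw [dslope_of_ne _ hne', slope_def_module, hends a ha hs, sub_zero, smul_eq_mul]
        have hi : (θ - a)⁻¹ ≠ 0 := inv_ne_zero (sub_ne_zero.2 hne')
        have hs' : sin θ ≠ 0 := by
          intro h
          rw [e1, h, mul_zero] at hθ
          exact hθ rfl
        rw [Pi.div_apply, e1, e2, if_neg hs', mul_div_mul_left _ _ hi]
    · refine ((hf a ha).div analyticAt_sin hs).congr ?_
      filter_upwards [continuous_sin.continuousAt.eventually_ne hs] with θ hθ
      rw [if_neg hθ, Pi.div_apply]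
  · by_cases hs : sin θ = 0
    · simp [hs, hends θ hθ hs]
    · simp [hs]

theorem polarCoeff_sub_mul {d : ℕ} {F G H : ℝ → ℝ} (hF : ContinuousOn F (Icc 0 π))
    (hG : ContinuousOn G (Icc 0 π)) (hH : ContinuousOn H (Icc 0 π)) (a b : ℝ) (k : ℕ) :
    polarCoeff d (fun θ => F θ - a * G θ - b * H θ) k =
      polarCoeff d F k - a * polarCoeff d G k - b * polarCoeff d H k := by
  have hi {F : ℝ → ℝ} (hF : ContinuousOn F (Icc 0 π)) : IntervalIntegrable
      (fun θ => F θ * (legendreP d k).eval (cos θ) * sin θ ^ (d - 2)) MeasureTheory.volume 0 π := by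
    have cp : Continuous fun θ => (legendreP d k).eval (cos θ) :=
      (legendreP d k).continuous.comp continuous_cos
    apply ContinuousOn.intervalIntegrable
    rw [uIcc_of_le pi_pos.le]
    fun_prop
  unfold polarCoeff
  rw [← intervalIntegral.integral_const_mul, ← intervalIntegral.integral_const_mul,
    ← intervalIntegral.integral_sub (hi hF) ((hi hG).const_mul a),
    ← intervalIntegral.integral_sub ((hi hF).sub ((hi hG).const_mul a)) ((hi hH).const_mul b)]
  refine intervalIntegral.integral_congr fun θ _ => ?_
  ring

theorem exists_polarCoeff_reduction {d : ℕ} (hd : 2 ≤ d) {F : ℝ → ℝ}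
    (hF : AnalyticOnNhd ℝ F (Icc 0 π)) :
    ∃ G, AnalyticOnNhd ℝ G (Icc 0 π) ∧ ∀ k : ℕ,
      (k : ℝ) * (k + d - 2) * (polarCoeff d F k -
        2 * (deriv F 0 - (-1) ^ k * deriv F π) * polarCoeff d (fun θ => sin (θ / 2)) k) =
      -polarCoeff d G k := by
  have m0 : (0 : ℝ) ∈ Icc 0 π := left_mem_Icc.2 pi_pos.le
  have mπ : π ∈ Icc 0 π := right_mem_Icc.2 pi_pos.le
  -- `sin (θ / 2)` has slopes `1 / 2` and `0` at `0` and `π`, and `cos (θ / 2)` has slopes `0` and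
  -- `-1 / 2`; these multiples make `F₁` flat at both poles.
  set a := 2 * deriv F 0 with ha
  set b := -2 * deriv F π with hb
  set F₁ : ℝ → ℝ := fun θ => F θ - a * sin (θ / 2) - b * cos (θ / 2) with hF₁
  have hder (θ : ℝ) (hθ : θ ∈ Icc 0 π) : HasDerivAt F₁
      (deriv F θ - a * (cos (θ / 2) * (1 / 2)) - b * (-sin (θ / 2) * (1 / 2))) θ := by
    have h := (hasDerivAt_id θ).div_const 2
    exact ((hF θ hθ).differentiableAt.hasDerivAt.sub (h.sin.const_mul a)).sub (h.cos.const_mul b)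
  have hs : AnalyticOnNhd ℝ (fun θ : ℝ => sin (θ / 2)) (Icc 0 π) := fun θ _ => by fun_prop
  have hc : AnalyticOnNhd ℝ (fun θ : ℝ => cos (θ / 2)) (Icc 0 π) := fun θ _ => by fun_prop
  have hF₁a : AnalyticOnNhd ℝ F₁ (Icc 0 π) := fun θ hθ =>
    ((hF θ hθ).sub (analyticAt_const.mul (hs θ hθ))).sub (analyticAt_const.mul (hc θ hθ))
  obtain ⟨g, hg, hgs⟩ := exists_analyticOnNhd_mul_sin hF₁a.deriv
    (by rw [(hder 0 m0).deriv]; simp [ha]; ring) (by rw [(hder π mπ).deriv]; simp [hb]; ring)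
  refine ⟨fun θ => deriv g θ * sin θ + ((d : ℝ) - 1) * (g θ * cos θ), fun θ hθ => ?_, fun k => ?_⟩
  · exact ((hg.deriv θ hθ).mul analyticAt_sin).add
      (analyticAt_const.mul ((hg θ hθ).mul analyticAt_cos))
  · rw [← polarCoeff_eq_of_hasDerivAt hd k (F := F₁) (fun θ hθ => ?_)
      (fun θ hθ => (hg θ hθ).differentiableAt.hasDerivAt) hg.deriv.continuousOn,
      polarCoeff_sub_mul hF.continuousOn hs.continuousOn hc.continuousOn, polarCoeff_cos_half hd]
    · rw [ha, hb]
      ring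
    · rw [← hgs θ hθ]
      exact (hF₁a θ hθ).differentiableAt.hasDerivAt

theorem polarCoeff_sin_half_bound {d : ℕ} (hd : 2 ≤ d) :
    ∃ M : ℝ, 0 ≤ M ∧ ∀ k : ℕ, (k : ℝ) ^ d * |polarCoeff d (fun θ => sin (θ / 2)) k| ≤ M := by
  obtain ⟨c, -, hc⟩ := tendsto_polarCoeff_sin_half hd
  obtain ⟨M, hM⟩ := hc.abs.bddAbove_range
  have h (k : ℕ) : (k : ℝ) ^ d * |polarCoeff d (fun θ => sin (θ / 2)) k| ≤ M := by
    have := hM ⟨k, rfl⟩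
    simpa [abs_mul] using this
  exact ⟨M, le_trans (by positivity) (h 0), h⟩

/-- Each reduction step gains at least one power of `k`, until the order `k^(-d)` of the subtracted
half-angle terms is reached. -/
theorem polarCoeff_bound {d : ℕ} (hd : 2 ≤ d) (m : ℕ) (hm : m ≤ d) {F : ℝ → ℝ}
    (hF : AnalyticOnNhd ℝ F (Icc 0 π)) :
    ∃ M : ℝ, ∀ k : ℕ, (k : ℝ) ^ m * |polarCoeff d F k| ≤ M := by
  have hd' : (2 : ℝ) ≤ d := by exact_mod_cast hd
  induction m generalizing F with
  | zero => simpa using abs_polarCoeff_le hd hF.continuousOn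
  | succ m ih =>
    obtain ⟨G, hG, hred⟩ := exists_polarCoeff_reduction hd hF
    obtain ⟨M, hM⟩ := ih (by omega) hG
    obtain ⟨M', hM'0, hM'⟩ := polarCoeff_sin_half_bound hd
    have hM0 : 0 ≤ M := le_trans (by positivity) (hM 0)
    set R := 2 * (|deriv F 0| + |deriv F π|) with hR
    refine ⟨M + R * M', fun k => ?_⟩
    rcases Nat.eq_zero_or_pos k with rfl | hk
    · simp
      positivity
    have hk' : (1 : ℝ) ≤ k := by exact_mod_cast hk
    set S := polarCoeff d (fun θ => sin (θ / 2)) k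
    set a := 2 * (deriv F 0 - (-1) ^ k * deriv F π) with ha
    have haR : |a| ≤ R := by
      rw [ha, hR, abs_mul, abs_two]
      gcongr
      refine (abs_sub _ _).trans ?_
      rw [abs_mul, abs_pow, abs_neg, abs_one, one_pow, one_mul]
    have h1 : (k : ℝ) * |polarCoeff d F k - a * S| ≤ |polarCoeff d G k| := by
      have h := congrArg abs (hred k)
      rw [abs_neg] at h
      rw [← h, abs_mul]
      gcongr
      rw [abs_of_nonneg (by nlinarith)]
      nlinarith
    calc (k : ℝ) ^ (m + 1) * |polarCoeff d F k|
        = (k : ℝ) ^ (m + 1) * |(polarCoeff d F k - a * S) + a * S| := by rw [sub_add_cancel]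
      _ ≤ (k : ℝ) ^ (m + 1) * (|polarCoeff d F k - a * S| + |a| * |S|) := by
          gcongr
          rw [← abs_mul]
          exact abs_add_le _ _
      _ = (k : ℝ) ^ m * (k * |polarCoeff d F k - a * S|) + |a| * ((k : ℝ) ^ (m + 1) * |S|) := by
          ring
      _ ≤ (k : ℝ) ^ m * |polarCoeff d G k| + R * ((k : ℝ) ^ d * |S|) := by gcongr
      _ ≤ M + R * M' := by
          gcongr
          · exact hM k
          · exact hM' k

/-- The Legendre coefficients of a function analytic in the polar angle are of order `k^(-d)`, with
limits along each parity given by the derivatives at the two poles. -/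
theorem exists_tendsto_polarCoeff {d : ℕ} (hd : 2 ≤ d) :
    ∃ c : ℝ, 0 < c ∧ ∀ F : ℝ → ℝ, AnalyticOnNhd ℝ F (Icc 0 π) →
      Tendsto (fun m : ℕ => ((2 * m : ℕ) : ℝ) ^ d * polarCoeff d F (2 * m)) atTop
        (𝓝 (c * (-deriv F 0 + deriv F π))) ∧
      Tendsto (fun m : ℕ => ((2 * m + 1 : ℕ) : ℝ) ^ d * polarCoeff d F (2 * m + 1)) atTop
        (𝓝 (c * (-deriv F 0 - deriv F π))) := by
  have hd' : (2 : ℝ) ≤ d := by exact_mod_cast hd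
  obtain ⟨c, hc, hlim⟩ := tendsto_polarCoeff_sin_half hd
  refine ⟨2 * c, by positivity, fun F hF => ?_⟩
  set S := polarCoeff d (fun θ => sin (θ / 2)) with hS
  set a : ℕ → ℝ := fun k => 2 * (deriv F 0 - (-1) ^ k * deriv F π) with ha
  -- The reduced function already has coefficients `O(k^(-d))`, so the factor `k (k + d - 2) ≥ k`
  -- makes the remainder `O(k^(-d-1))`.
  have hrem : Tendsto (fun k : ℕ => (k : ℝ) ^ d * (polarCoeff d F k - a k * S k)) atTop (𝓝 0) := by
    obtain ⟨G, hG, hred⟩ := exists_polarCoeff_reduction hd hF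
    obtain ⟨M, hM⟩ := polarCoeff_bound hd d le_rfl hG
    refine squeeze_zero_norm' ?_ (tendsto_const_div_atTop_nhds_zero_nat M)
    filter_upwards [eventually_ge_atTop 1] with k hk
    have hk' : (1 : ℝ) ≤ k := by exact_mod_cast hk
    rw [le_div_iff₀ (by linarith), norm_mul, norm_pow, norm_eq_abs, norm_eq_abs, Nat.abs_cast]
    refine le_trans ?_ (hM k)
    have h := congrArg abs (hred k)
    rw [abs_neg] at h
    rw [← h, abs_mul, mul_assoc, mul_comm |_| (k : ℝ)]
    gcongr
    rw [abs_of_nonneg (by nlinarith)]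
    nlinarith
  have he : Tendsto (fun m : ℕ => 2 * m) atTop atTop :=
    tendsto_id.const_mul_atTop' two_pos
  have ho : Tendsto (fun m : ℕ => 2 * m + 1) atTop atTop := (tendsto_add_atTop_nat 1).comp he
  constructor
  · have h := (hrem.comp he).add ((hlim.comp he).const_mul (2 * (deriv F 0 - deriv F π)))
    convert h using 1
    · ext m
      simp only [Function.comp_apply, ha, pow_mul, neg_one_sq, one_pow]
      ring
    · ring_nf
  · have h := (hrem.comp ho).add ((hlim.comp ho).const_mul (2 * (deriv F 0 + deriv F π)))
    convert h using 1
    · ext m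
      simp only [Function.comp_apply, ha, pow_succ (-1 : ℝ), pow_mul]
      ring
    · ring_nf

open scoped ContDiff

theorem analyticAt_dslope {f : ℝ → ℝ} (hf : ∀ x, AnalyticAt ℝ f x) (a x : ℝ) :
    AnalyticAt ℝ (dslope f a) x := by
  rcases eq_or_ne x a with rfl | h
  · exact analyticAt_dslope_self (hf x)
  · have h1 : AnalyticAt ℝ (fun y => (y - a)⁻¹ * (f y - f a)) x :=
      ((analyticAt_id.sub analyticAt_const).inv (sub_ne_zero.2 h)).mul
        ((hf x).sub analyticAt_const)
    refine h1.congr ?_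
    filter_upwards [dslope_eventuallyEq_slope_of_ne f h] with y hy
    rw [hy, slope_def_module, smul_eq_mul]

/-! ### The arc-cosine functions in the polar angle -/

/-- The function `κ₁(cos θ)`, continued analytically from `[0, π]` to `ℝ`. -/
noncomputable def polarKappa (θ : ℝ) : ℝ := (cos θ * (π - θ) + sin θ) / π

theorem kappa1_cos {θ : ℝ} (hθ : θ ∈ Icc 0 π) : kappa1 (cos θ) = polarKappa θ := by
  rw [kappa1, polarKappa, arccos_cos hθ.1 hθ.2, ← sin_sq,
    sqrt_sq (sin_nonneg_of_nonneg_of_le_pi hθ.1 hθ.2)]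

theorem kappa0_cos {θ : ℝ} (hθ : θ ∈ Icc 0 π) : kappa0 (cos θ) = 1 - θ / π := by
  rw [kappa0, arccos_cos hθ.1 hθ.2, sub_div, div_self pi_ne_zero]

theorem analyticAt_polarKappa (θ : ℝ) : AnalyticAt ℝ polarKappa θ := by
  unfold polarKappa
  exact ((analyticAt_cos.mul (analyticAt_const.sub analyticAt_id)).add analyticAt_sin).div
    analyticAt_const pi_ne_zero

theorem hasDerivAt_polarKappa (θ : ℝ) :
    HasDerivAt polarKappa (-(sin θ * (π - θ) / π)) θ := by
  refine ((((hasDerivAt_cos θ).mul ((hasDerivAt_id θ).const_sub π)).add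
    (hasDerivAt_sin θ)).div_const π).congr_deriv ?_
  simp only [id]
  ring

theorem polarKappa_zero : polarKappa 0 = 1 := by simp [polarKappa, pi_ne_zero]

theorem polarKappa_pi : polarKappa π = 0 := by simp [polarKappa]

theorem strictAntiOn_polarKappa : StrictAntiOn polarKappa (Icc 0 π) := by
  refine strictAntiOn_of_deriv_neg (convex_Icc _ _)
    (fun θ _ => (hasDerivAt_polarKappa θ).continuousAt.continuousWithinAt) fun θ hθ => ?_
  rw [interior_Icc] at hθ
  rw [(hasDerivAt_polarKappa θ).deriv, neg_lt_zero]
  have h1 := sin_pos_of_pos_of_lt_pi hθ.1 hθ.2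
  have h2 := sub_pos.2 hθ.2
  positivity

/-- The quotient `(1 - κ₁(cos θ)) / θ²`. -/
noncomputable def polarDefect : ℝ → ℝ := dslope (dslope (fun θ => 1 - polarKappa θ) 0) 0

theorem analyticAt_one_sub_polarKappa (θ : ℝ) : AnalyticAt ℝ (fun θ => 1 - polarKappa θ) θ :=
  analyticAt_const.sub (analyticAt_polarKappa θ)

theorem analyticAt_polarDefect (θ : ℝ) : AnalyticAt ℝ polarDefect θ :=
  analyticAt_dslope (analyticAt_dslope analyticAt_one_sub_polarKappa 0) 0 θ

theorem mul_dslope_one_sub_polarKappa (θ : ℝ) :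
    θ * dslope (fun θ => 1 - polarKappa θ) 0 θ = 1 - polarKappa θ := by
  simpa [polarKappa_zero] using sub_smul_dslope (fun θ => 1 - polarKappa θ) 0 θ

theorem dslope_one_sub_polarKappa_zero : dslope (fun θ => 1 - polarKappa θ) 0 0 = 0 := by
  rw [dslope_same, ((hasDerivAt_polarKappa 0).const_sub 1).deriv]
  simp

theorem sq_mul_polarDefect (θ : ℝ) : θ ^ 2 * polarDefect θ = 1 - polarKappa θ := by
  have h := sub_smul_dslope (dslope (fun θ => 1 - polarKappa θ) 0) 0 θ
  rw [dslope_one_sub_polarKappa_zero, smul_eq_mul, sub_zero, sub_zero] at h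
  rw [← mul_dslope_one_sub_polarKappa, ← h, polarDefect]
  ring

/-- Write `1 - polarKappa θ = θ * e θ`. Differentiating twice at `0` gives `2 * e' 0 = 1`, and
`polarDefect 0` is `e' 0`. -/
theorem polarDefect_zero : polarDefect 0 = 1 / 2 := by
  set e := dslope (fun θ => 1 - polarKappa θ) 0 with he
  have ha : ∀ θ, AnalyticAt ℝ e θ := analyticAt_dslope analyticAt_one_sub_polarKappa 0
  have heq : (fun θ => e θ + θ * deriv e θ) = fun θ => sin θ * (π - θ) / π := by
    ext θ
    have h1 := (hasDerivAt_id θ).mul (ha θ).differentiableAt.hasDerivAt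
    have h2 := (hasDerivAt_polarKappa θ).const_sub 1
    have h3 : (id * e) = fun θ => 1 - polarKappa θ := by
      ext θ
      exact mul_dslope_one_sub_polarKappa θ
    rw [h3] at h1
    have := h1.unique h2
    simp only [id, one_mul, neg_neg] at this
    exact this
  have h1 : HasDerivAt (fun θ => e θ + θ * deriv e θ)
      (deriv e 0 + (1 * deriv e 0 + 0 * deriv (deriv e) 0)) 0 :=
    (ha 0).differentiableAt.hasDerivAt.add
      ((hasDerivAt_id (0 : ℝ)).mul (ha 0).deriv.differentiableAt.hasDerivAt)
  have h2 : HasDerivAt (fun θ => sin θ * (π - θ) / π) ((cos 0 * (π - 0) + sin 0 * -1) / π) 0 :=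
    ((hasDerivAt_sin 0).mul ((hasDerivAt_id (0 : ℝ)).const_sub π)).div_const π
  rw [heq] at h1
  have h3 := h1.unique h2
  simp [pi_ne_zero] at h3
  rw [polarDefect, dslope_same]
  linarith

theorem polarDefect_pos {θ : ℝ} (hθ : θ ∈ Icc 0 π) : 0 < polarDefect θ := by
  rcases hθ.1.eq_or_lt with h | h
  · rw [← h, polarDefect_zero]
    norm_num
  · have h1 := strictAntiOn_polarKappa (left_mem_Icc.2 pi_pos.le) hθ h
    rw [polarKappa_zero, ← sub_pos, ← sq_mul_polarDefect] at h1
    exact (pos_iff_pos_of_mul_pos h1).1 (by positivity)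

/-- The map induced by `κ₁` on the polar angle: `cos (polarMap θ) = κ₁(cos θ)`. -/
noncomputable def polarMap (θ : ℝ) : ℝ := 2 * arcsin (θ * √(polarDefect θ / 2))

theorem mul_sqrt_polarDefect_mem {θ : ℝ} (hθ : θ ∈ Icc 0 π) :
    θ * √(polarDefect θ / 2) ∈ Ico 0 1 := by
  have h := polarDefect_pos hθ
  refine ⟨mul_nonneg hθ.1 (sqrt_nonneg _), ?_⟩
  have h1 : polarKappa π ≤ polarKappa θ :=
    strictAntiOn_polarKappa.antitoneOn hθ (right_mem_Icc.2 pi_pos.le) hθ.2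
  -- Nonnegativity of `polarKappa` bounds the square of the argument by `1 / 2`, away from the
  -- singularity of `arcsin`.
  rw [polarKappa_pi] at h1
  refine lt_of_pow_lt_pow_left₀ 2 zero_le_one ?_
  rw [mul_pow, sq_sqrt (by positivity), mul_div_assoc', sq_mul_polarDefect]
  linarith

theorem cos_polarMap {θ : ℝ} (hθ : θ ∈ Icc 0 π) : cos (polarMap θ) = polarKappa θ := by
  have h := polarDefect_pos hθ
  obtain ⟨h0, h1⟩ := mul_sqrt_polarDefect_mem hθ
  rw [polarMap, cos_two_mul, cos_sq', sin_arcsin (by linarith) h1.le, mul_pow,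
    sq_sqrt (by positivity), mul_div_assoc', sq_mul_polarDefect]
  ring

theorem polarMap_mem_Ico {θ : ℝ} (hθ : θ ∈ Icc 0 π) : polarMap θ ∈ Ico 0 π := by
  obtain ⟨h0, h1⟩ := mul_sqrt_polarDefect_mem hθ
  have h2 := arcsin_nonneg.2 h0
  have h3 := arcsin_lt_pi_div_two.2 h1
  unfold polarMap
  constructor <;> linarith

theorem mapsTo_polarMap : MapsTo polarMap (Icc 0 π) (Icc 0 π) :=
  fun _ hθ => Ico_subset_Icc_self (polarMap_mem_Ico hθ)

/-- The half-angle form `1 - cos φ = 2 sin (φ / 2) ^ 2` lets the square root of `1 - κ₁` be taken as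
`θ` times the root of a positive analytic function, which avoids the singularity of `arccos` at `1`.
-/
theorem analyticOnNhd_polarMap : AnalyticOnNhd ℝ polarMap (Icc 0 π) := by
  intro θ hθ
  have h := polarDefect_pos hθ
  obtain ⟨h0, h1⟩ := mul_sqrt_polarDefect_mem hθ
  have hs : AnalyticAt ℝ (fun x => √(polarDefect x / 2)) θ :=
    (contDiffAt_sqrt (n := ω) (x := polarDefect θ / 2) (by positivity)).analyticAt.fun_comp
      (f := fun x => polarDefect x / 2)
      ((analyticAt_polarDefect θ).div analyticAt_const two_ne_zero)
  have ha : AnalyticAt ℝ (fun x => arcsin (x * √(polarDefect x / 2))) θ :=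
    (contDiffAt_arcsin (n := ω) (x := θ * √(polarDefect θ / 2)) (by linarith)
      h1.ne).analyticAt.fun_comp (f := fun x => x * √(polarDefect x / 2)) (analyticAt_id.mul hs)
  exact analyticAt_const.mul ha

theorem polarMap_zero : polarMap 0 = 0 := by simp [polarMap]

theorem hasDerivAt_polarMap_zero : HasDerivAt polarMap 1 0 := by
  have h0 : (0 : ℝ) ∈ Icc 0 π := left_mem_Icc.2 pi_pos.le
  have hs : √(polarDefect 0 / 2) = 1 / 2 := by
    rw [polarDefect_zero, show (1 / 2 / 2 : ℝ) = (1 / 2) ^ 2 by norm_num, sqrt_sq (by norm_num)]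
  have hd : HasDerivAt (fun x => √(polarDefect x / 2))
      (deriv (fun x => √(polarDefect x / 2)) 0) 0 := by
    refine DifferentiableAt.hasDerivAt (DifferentiableAt.sqrt ?_ ?_)
    · exact (analyticAt_polarDefect 0).differentiableAt.div_const 2
    · rw [polarDefect_zero]
      norm_num
  have h1 := (hasDerivAt_id (0 : ℝ)).mul hd
  have h2 : HasDerivAt arcsin (1 / √(1 - (0 * √(polarDefect 0 / 2)) ^ 2))
      (0 * √(polarDefect 0 / 2)) :=
    hasDerivAt_arcsin (by norm_num) (by norm_num)
  refine ((h2.comp (0 : ℝ) h1).const_mul 2).congr_deriv ?_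
  simp [hs]

theorem hasDerivAt_polarMap_pi : HasDerivAt polarMap 0 π := by
  have hπ : π ∈ Icc 0 π := right_mem_Icc.2 pi_pos.le
  have h := (analyticOnNhd_polarMap π hπ).differentiableAt.hasDerivAt
  -- The relation `cos ∘ polarMap = polarKappa` is available only on `[0, π]`, hence one-sided
  -- derivatives. At `π` the right side is flat and `sin (polarMap π) ≠ 0`.
  have h1 : HasDerivWithinAt polarKappa (-sin (polarMap π) * deriv polarMap π) (Icc 0 π) π :=
    h.cos.hasDerivWithinAt.congr (fun θ hθ => (cos_polarMap hθ).symm) (cos_polarMap hπ).symm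
  have h2 := (uniqueDiffOn_Icc pi_pos π hπ).eq_deriv _ h1
    (hasDerivAt_polarKappa π).hasDerivWithinAt
  have hs : sin (polarMap π) ≠ 0 := by
    intro hs
    have := sin_sq_add_cos_sq (polarMap π)
    rw [hs, cos_polarMap hπ, polarKappa_pi] at this
    norm_num at this
  simp [hs] at h2
  rwa [h2] at h

/-! ### Iterates of the angle map, and the slopes of the NTK at the poles -/

theorem analyticOnNhd_iterate_polarMap (n : ℕ) : AnalyticOnNhd ℝ polarMap^[n] (Icc 0 π) := by
  induction n with
  | zero => exact analyticOnNhd_id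
  | succ n ih =>
    rw [Function.iterate_succ]
    exact ih.comp analyticOnNhd_polarMap mapsTo_polarMap

theorem hasDerivAt_iterate_polarMap_pi (n : ℕ) : HasDerivAt polarMap^[n + 1] 0 π := by
  have hπ : π ∈ Icc 0 π := right_mem_Icc.2 pi_pos.le
  have h := (analyticOnNhd_iterate_polarMap n _
    (mapsTo_polarMap hπ)).differentiableAt.hasDerivAt.comp π hasDerivAt_polarMap_pi
  rw [mul_zero] at h
  exact h

theorem rfKernel_cos (n : ℕ) {θ : ℝ} (hθ : θ ∈ Icc 0 π) :
    rfKernel (n + 1) (cos θ) = cos (polarMap^[n] θ) := by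
  rw [rfKernel, Nat.add_sub_cancel]
  induction n with
  | zero => rfl
  | succ n ih =>
    have hm := mapsTo_polarMap.iterate n hθ
    rw [Function.iterate_succ_apply', Function.iterate_succ_apply', ih, kappa1_cos hm,
      cos_polarMap hm]

/-- The neural tangent kernel function of `n + 1` layers in the polar angle. -/
noncomputable def polarNTK : ℕ → ℝ → ℝ
  | 0, θ => cos θ
  | n + 1, θ => polarNTK n θ * (1 - polarMap^[n] θ / π) + cos (polarMap^[n + 1] θ)

theorem ntkKernel_cos (n : ℕ) {θ : ℝ} (hθ : θ ∈ Icc 0 π) :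
    ntkKernel (n + 1) (cos θ) = polarNTK n θ := by
  induction n with
  | zero => rfl
  | succ n ih =>
    rw [ntkKernel, polarNTK, ih, rfKernel_cos n hθ, rfKernel_cos (n + 1) hθ,
      kappa0_cos (mapsTo_polarMap.iterate n hθ)]

theorem analyticOnNhd_polarNTK (n : ℕ) : AnalyticOnNhd ℝ (polarNTK n) (Icc 0 π) := by
  induction n with
  | zero => exact fun θ _ => analyticAt_cos
  | succ n ih =>
    intro θ hθ
    exact ((ih θ hθ).mul (analyticAt_const.sub
      ((analyticOnNhd_iterate_polarMap n θ hθ).div analyticAt_const pi_ne_zero))).add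
      (analyticAt_cos.fun_comp (analyticOnNhd_iterate_polarMap (n + 1) θ hθ))

theorem hasDerivAt_polarNTK_succ {n : ℕ} {θ a b c : ℝ} (ha : HasDerivAt (polarNTK n) a θ)
    (hb : HasDerivAt polarMap^[n] b θ) (hc : HasDerivAt polarMap^[n + 1] c θ) :
    HasDerivAt (polarNTK (n + 1)) (a * (1 - polarMap^[n] θ / π) + polarNTK n θ * -(b / π) +
      -sin (polarMap^[n + 1] θ) * c) θ :=
  (ha.mul ((hb.div_const π).const_sub 1)).add hc.cos

theorem polarNTK_zero_right (n : ℕ) : polarNTK n 0 = n + 1 := by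
  induction n with
  | zero => simp [polarNTK]
  | succ n ih =>
    rw [polarNTK, ih, Function.iterate_fixed polarMap_zero, Function.iterate_fixed polarMap_zero]
    simp

theorem deriv_polarNTK_zero (n : ℕ) :
    deriv (polarNTK n) 0 = -(n * (n + 1) / (2 * π)) := by
  induction n with
  | zero =>
    rw [show polarNTK 0 = cos from rfl, Real.deriv_cos]
    simp
  | succ n ih =>
    have hit (n : ℕ) : HasDerivAt polarMap^[n] 1 0 := by
      simpa using HasDerivAt.iterate (0 : ℝ) hasDerivAt_polarMap_zero polarMap_zero n
    have h0 : (0 : ℝ) ∈ Icc 0 π := left_mem_Icc.2 pi_pos.le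
    rw [(hasDerivAt_polarNTK_succ (analyticOnNhd_polarNTK n 0 h0).differentiableAt.hasDerivAt
      (hit n) (hit (n + 1))).deriv, ih, polarNTK_zero_right, Function.iterate_fixed polarMap_zero,
      Function.iterate_fixed polarMap_zero]
    push_cast
    field_simp
    simp
    ring

theorem deriv_polarNTK_one_pi : deriv (polarNTK 1) π = 1 / π := by
  rw [(hasDerivAt_polarNTK_succ (n := 0) (hasDerivAt_cos π) (hasDerivAt_id π)
    (hasDerivAt_iterate_polarMap_pi 0)).deriv]
  simp [polarNTK]

/-- Since the iterates of `polarMap` are flat at `π`, each further layer only multiplies the slope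
by `1 - polarMap^[n + 1] π / π`, which lies in `(0, 1]`. -/
theorem deriv_polarNTK_pi (n : ℕ) : deriv (polarNTK (n + 1)) π ∈ Ioc 0 (1 / π) := by
  induction n with
  | zero =>
    rw [deriv_polarNTK_one_pi]
    exact ⟨by positivity, le_rfl⟩
  | succ n ih =>
    have hπ : π ∈ Icc 0 π := right_mem_Icc.2 pi_pos.le
    rw [(hasDerivAt_polarNTK_succ (analyticOnNhd_polarNTK (n + 1) π hπ).differentiableAt.hasDerivAt
      (hasDerivAt_iterate_polarMap_pi n) (hasDerivAt_iterate_polarMap_pi (n + 1))).deriv]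
    simp only [zero_div, neg_zero, mul_zero, add_zero]
    have hm : polarMap^[n + 1] π ∈ Ico 0 π := by
      rw [Function.iterate_succ_apply']
      exact polarMap_mem_Ico (mapsTo_polarMap.iterate n hπ)
    have h1 : 0 ≤ polarMap^[n + 1] π / π := div_nonneg hm.1 pi_pos.le
    have h2 : polarMap^[n + 1] π / π < 1 := (div_lt_one pi_pos).2 hm.2
    exact ⟨mul_pos ih.1 (by linarith), (mul_le_of_le_one_right ih.1.le (by linarith)).trans ih.2⟩

/-! ### From limits to asymptotic equivalents of the eigenvalues -/

theorem sphereArea_pos {p : ℝ} (hp : 0 < p) : 0 < sphereArea p := by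
  have := Gamma_pos_of_pos (half_pos hp)
  unfold sphereArea
  positivity

theorem eigenvalue_div_const (d : ℕ) (κ : ℝ → ℝ) (a : ℝ) (k : ℕ) :
    eigenvalue d (fun t => κ t / a) k = eigenvalue d κ k / a := by
  unfold eigenvalue
  rw [mul_div_assoc, ← intervalIntegral.integral_div]
  congr 1
  refine intervalIntegral.integral_congr fun t _ => ?_
  ring

theorem polarCoeff_congr (d : ℕ) {F G : ℝ → ℝ} (h : EqOn F G (Icc 0 π)) (k : ℕ) :
    polarCoeff d F k = polarCoeff d G k := by
  refine intervalIntegral.integral_congr fun θ hθ => ?_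
  rw [uIcc_of_le pi_pos.le] at hθ
  simp only [h hθ]

/-- The eigenvalues of the neural tangent kernel are of order `k^(-d)`, with limits along each
parity. -/
theorem exists_tendsto_eigenvalue_ntkKernel {d : ℕ} (hd : 2 ≤ d) :
    ∃ c : ℝ, 0 < c ∧ ∀ n : ℕ,
      Tendsto (fun m : ℕ => ((2 * m : ℕ) : ℝ) ^ d * eigenvalue d (ntkKernel (n + 1)) (2 * m)) atTop
        (𝓝 (c * (n * (n + 1) / (2 * π) + deriv (polarNTK n) π))) ∧
      Tendsto (fun m : ℕ => ((2 * m + 1 : ℕ) : ℝ) ^ d *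
        eigenvalue d (ntkKernel (n + 1)) (2 * m + 1)) atTop
        (𝓝 (c * (n * (n + 1) / (2 * π) - deriv (polarNTK n) π))) := by
  have hd' : (2 : ℝ) ≤ d := by exact_mod_cast hd
  obtain ⟨c, hc, hlim⟩ := exists_tendsto_polarCoeff hd
  have hA : 0 < sphereArea ((d : ℝ) - 1) / sphereArea d :=
    div_pos (sphereArea_pos (by linarith)) (sphereArea_pos (by linarith))
  refine ⟨sphereArea ((d : ℝ) - 1) / sphereArea d * c, by positivity, fun n => ?_⟩
  obtain ⟨h1, h2⟩ := hlim _ (analyticOnNhd_polarNTK n)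
  have he (k : ℕ) : eigenvalue d (ntkKernel (n + 1)) k =
      sphereArea ((d : ℝ) - 1) / sphereArea d * polarCoeff d (polarNTK n) k := by
    rw [eigenvalue_eq_polarCoeff hd, polarCoeff_congr d fun θ hθ => ntkKernel_cos n hθ]
  rw [deriv_polarNTK_zero, neg_neg] at h1 h2
  simp only [he, mul_left_comm _ (sphereArea _ / _), mul_assoc _ c]
  exact ⟨h1.const_mul _, h2.const_mul _⟩

theorem isEquivalent_const_mul_zpow {u : ℕ → ℝ} {x : ℕ → ℕ} {d : ℕ} {C : ℝ} (hC : C ≠ 0)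
    (hx : Tendsto x atTop atTop) (h : Tendsto (fun m => (x m : ℝ) ^ d * u m) atTop (𝓝 C)) :
    u ~[atTop] fun m => C * (x m : ℝ) ^ (-(d : ℤ)) := by
  have hx0 : ∀ᶠ m in atTop, (x m : ℝ) ≠ 0 := by
    filter_upwards [hx.eventually_ge_atTop 1] with m hm
    have : 0 < x m := hm
    positivity
  rw [isEquivalent_iff_tendsto_one]
  · have h' := h.div_const C
    rw [div_self hC] at h'
    refine h'.congr' ?_
    filter_upwards [hx0] with m hm
    rw [Pi.div_apply, zpow_neg, zpow_natCast]
    field_simp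
  · filter_upwards [hx0] with m hm
    exact mul_ne_zero hC (zpow_ne_zero _ hm)

theorem isEquivalent_mul_sq {u : ℕ → ℝ} {K M : ℝ} (hK : K ≠ 0)
    (h : ∀ᶠ L : ℕ in atTop, |u L - K * (L : ℝ) ^ 2| ≤ M * L) :
    u ~[atTop] fun L => K * (L : ℝ) ^ 2 := by
  have h1 : (u - fun L : ℕ => K * (L : ℝ) ^ 2) =O[atTop] fun L : ℕ => (L : ℝ) := by
    refine IsBigO.of_bound M ?_
    filter_upwards [h] with L hL
    simpa using hL
  have h2 : (fun L : ℕ => (L : ℝ)) =o[atTop] fun L : ℕ => K * (L : ℝ) ^ 2 := by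
    refine IsLittleO.const_mul_right hK ?_
    have := (isLittleO_pow_pow_atTop_of_lt (𝕜 := ℝ) one_lt_two).comp_tendsto
      (tendsto_natCast_atTop_atTop (R := ℝ))
    simpa [Function.comp_def] using this
  exact h1.trans_isLittleO h2

theorem tendsto_two_mul_atTop : Tendsto (fun m : ℕ => 2 * m) atTop atTop :=
  tendsto_id.const_mul_atTop' two_pos

theorem tendsto_two_mul_add_one_atTop : Tendsto (fun m : ℕ => 2 * m + 1) atTop atTop :=
  (tendsto_add_atTop_nat 1).comp tendsto_two_mul_atTop

/-- The decay of the eigenvalues of the deep neural tangent kernels, with the growth in the depth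
of its constants. -/
theorem exists_isEquivalent_eigenvalue_ntkKernel {d : ℕ} (hd : 2 ≤ d) :
    ∃ Ceven Codd : ℕ → ℝ,
      (∀ L : ℕ, 3 ≤ L →
        0 < Ceven L ∧ 0 < Codd L ∧ Ceven L ≠ Codd L ∧
        (fun m : ℕ => eigenvalue d (ntkKernel L) (2 * m))
          ~[atTop] (fun m : ℕ => Ceven L * ((2 * m : ℕ) : ℝ) ^ (-(d : ℤ))) ∧
        (fun m : ℕ => eigenvalue d (ntkKernel L) (2 * m + 1))
          ~[atTop] (fun m : ℕ => Codd L * ((2 * m + 1 : ℕ) : ℝ) ^ (-(d : ℤ)))) ∧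
      (∃ K : ℝ, 0 < K ∧
        Ceven ~[atTop] (fun L : ℕ => K * (L : ℝ) ^ 2) ∧
        Codd ~[atTop] (fun L : ℕ => K * (L : ℝ) ^ 2)) := by
  obtain ⟨c, hc, hlim⟩ := exists_tendsto_eigenvalue_ntkKernel hd
  set β : ℕ → ℝ := fun n => deriv (polarNTK n) π with hβ
  have hb (n : ℕ) : 0 < β (n + 1) ∧ β (n + 1) ≤ 1 / π := deriv_polarNTK_pi n
  refine ⟨fun L => c * (((L - 1 : ℕ) : ℝ) * (((L - 1 : ℕ) : ℝ) + 1) / (2 * π) + β (L - 1)),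
    fun L => c * (((L - 1 : ℕ) : ℝ) * (((L - 1 : ℕ) : ℝ) + 1) / (2 * π) - β (L - 1)),
    fun L hL => ?_, c / (2 * π), by positivity, ?_, ?_⟩
  · obtain ⟨n, rfl⟩ := Nat.exists_eq_add_of_le' hL
    simp only [show n + 3 - 1 = (n + 1) + 1 by omega]
    obtain ⟨h1, h2⟩ := hlim (n + 1 + 1)
    obtain ⟨hb0, hb1⟩ := hb (n + 1)
    -- Strict because the number of layers is at least three; for two layers this is an equality,
    -- and the odd constant vanishes.
    have hlt : 1 / π < ((n + 1 + 1 : ℕ) : ℝ) * (((n + 1 + 1 : ℕ) : ℝ) + 1) / (2 * π) := by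
      rw [div_lt_div_iff₀ pi_pos (by positivity), one_mul, mul_lt_mul_iff_left₀ pi_pos]
      have : (0 : ℝ) ≤ n := n.cast_nonneg
      push_cast
      nlinarith
    have he : 0 < c * (((n + 1 + 1 : ℕ) : ℝ) * (((n + 1 + 1 : ℕ) : ℝ) + 1) / (2 * π)
        + β (n + 1 + 1)) := mul_pos hc (by positivity)
    have ho : 0 < c * (((n + 1 + 1 : ℕ) : ℝ) * (((n + 1 + 1 : ℕ) : ℝ) + 1) / (2 * π)
        - β (n + 1 + 1)) := mul_pos hc (by linarith)
    refine ⟨he, ho, fun h => ?_, isEquivalent_const_mul_zpow he.ne' tendsto_two_mul_atTop h1,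
      isEquivalent_const_mul_zpow ho.ne' tendsto_two_mul_add_one_atTop h2⟩
    have := mul_left_cancel₀ hc.ne' h
    linarith
  all_goals
    -- Replacing `(L - 1) L` by `L ^ 2` costs `c / (2 π) * L`, and the slope at `π` contributes at
    -- most `c / π`.
    refine isEquivalent_mul_sq (M := c / (2 * π) + c / π) (by positivity) ?_
    filter_upwards [eventually_ge_atTop 2] with L hL
    obtain ⟨n, rfl⟩ := Nat.exists_eq_add_of_le' hL
    simp only [show n + 2 - 1 = n + 1 by omega]
    obtain ⟨hb0, hb1⟩ := hb n
    have hn : (0 : ℝ) ≤ n := n.cast_nonneg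
    have hcb : c * β (n + 1) ≤ c / π := by
      rw [← mul_one_div]
      gcongr
    have hcb0 : 0 < c * β (n + 1) := by positivity
    have e : c * (((n + 1 : ℕ) : ℝ) * (((n + 1 : ℕ) : ℝ) + 1) / (2 * π)) -
        c / (2 * π) * ((n + 2 : ℕ) : ℝ) ^ 2 = -(c / (2 * π) * (n + 2)) := by
      push_cast
      ring
    have hp : 0 ≤ c / (2 * π) * (n + 2) := by positivity
    have hq : c / π ≤ c / π * (n + 2) := le_mul_of_one_le_right (by positivity) (by linarith)
    rw [abs_le]
    constructor <;> push_cast at * <;> linarith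

theorem ntkKernel_apply_one (n : ℕ) : ntkKernel (n + 1) 1 = n + 1 := by
  have h := ntkKernel_cos n (left_mem_Icc.2 pi_pos.le)
  rwa [cos_zero, polarNTK_zero_right] at h

theorem exists_isEquivalent_eigenvalue_two {d : ℕ} (hd : 2 ≤ d) :
    ∃ C : ℝ, 0 < C ∧
      (fun m : ℕ => eigenvalue d (ntkKernel 2) (2 * m))
        ~[atTop] (fun m : ℕ => C * ((2 * m : ℕ) : ℝ) ^ (-(d : ℤ))) ∧
      (fun m : ℕ => eigenvalue d (ntkKernel 2) (2 * m + 1))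
        =o[atTop] (fun m : ℕ => ((2 * m + 1 : ℕ) : ℝ) ^ (-(d : ℤ))) := by
  obtain ⟨c, hc, hlim⟩ := exists_tendsto_eigenvalue_ntkKernel hd
  obtain ⟨h1, h2⟩ := hlim 1
  have hC : 0 < c * (((1 : ℕ) : ℝ) * (((1 : ℕ) : ℝ) + 1) / (2 * π) + deriv (polarNTK 1) π) := by
    rw [deriv_polarNTK_one_pi]
    positivity
  refine ⟨_, hC, isEquivalent_const_mul_zpow hC.ne' tendsto_two_mul_atTop h1, ?_⟩
  have h0 : c * (((1 : ℕ) : ℝ) * (((1 : ℕ) : ℝ) + 1) / (2 * π) - deriv (polarNTK 1) π) = 0 := by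
    rw [deriv_polarNTK_one_pi]
    field_simp
    norm_num
  rw [h0] at h2
  have hne (m : ℕ) : ((2 * m + 1 : ℕ) : ℝ) ≠ 0 := by positivity
  rw [isLittleO_iff_tendsto fun m h => absurd h (zpow_ne_zero _ (hne m))]
  refine h2.congr fun m => ?_
  rw [zpow_neg, zpow_natCast, div_inv_eq_mul, mul_comm]

end DeepNTK

theorem mainTheorem2 (d : ℕ) (hd : 2 ≤ d) :
    -- the deep neural tangent kernel
    (∃ Ceven Codd : ℕ → ℝ,
      (∀ L : ℕ, 3 ≤ L →
        0 < Ceven L ∧ 0 < Codd L ∧ Ceven L ≠ Codd L ∧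
        (fun m : ℕ => DeepNTK.eigenvalue d (DeepNTK.ntkKernel L) (2 * m))
          ~[atTop] (fun m : ℕ => Ceven L * ((2 * m : ℕ) : ℝ) ^ (-(d : ℤ))) ∧
        (fun m : ℕ => DeepNTK.eigenvalue d (DeepNTK.ntkKernel L) (2 * m + 1))
          ~[atTop] (fun m : ℕ => Codd L * ((2 * m + 1 : ℕ) : ℝ) ^ (-(d : ℤ)))) ∧
      (∃ K : ℝ, 0 < K ∧
        Ceven ~[atTop] (fun L : ℕ => K * (L : ℝ) ^ 2) ∧
        Codd ~[atTop] (fun L : ℕ => K * (L : ℝ) ^ 2))) ∧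
    -- the normalized kernel
    (∃ Ceven Codd : ℕ → ℝ,
      (∀ L : ℕ, 3 ≤ L →
        DeepNTK.ntkKernel L 1 / (L : ℝ) = 1 ∧
        0 < Ceven L ∧ 0 < Codd L ∧ Ceven L ≠ Codd L ∧
        (fun m : ℕ => DeepNTK.eigenvalue d (fun t => DeepNTK.ntkKernel L t / (L : ℝ)) (2 * m))
          ~[atTop] (fun m : ℕ => Ceven L * ((2 * m : ℕ) : ℝ) ^ (-(d : ℤ))) ∧
        (fun m : ℕ => DeepNTK.eigenvalue d (fun t => DeepNTK.ntkKernel L t / (L : ℝ)) (2 * m + 1))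
          ~[atTop] (fun m : ℕ => Codd L * ((2 * m + 1 : ℕ) : ℝ) ^ (-(d : ℤ)))) ∧
      (∃ K : ℝ, 0 < K ∧
        Ceven ~[atTop] (fun L : ℕ => K * (L : ℝ)) ∧
        Codd ~[atTop] (fun L : ℕ => K * (L : ℝ)))) ∧
    -- the two-layer kernel, whose decay is the same up to the parity constraint
    (∃ C : ℝ, 0 < C ∧
      (fun m : ℕ => DeepNTK.eigenvalue d (DeepNTK.ntkKernel 2) (2 * m))
        ~[atTop] (fun m : ℕ => C * ((2 * m : ℕ) : ℝ) ^ (-(d : ℤ))) ∧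
      (fun m : ℕ => DeepNTK.eigenvalue d (DeepNTK.ntkKernel 2) (2 * m + 1))
        =o[atTop] (fun m : ℕ => ((2 * m + 1 : ℕ) : ℝ) ^ (-(d : ℤ)))) := by
  obtain ⟨Ceven, Codd, hL, K, hK, he, ho⟩ := DeepNTK.exists_isEquivalent_eigenvalue_ntkKernel hd
  refine ⟨⟨Ceven, Codd, hL, K, hK, he, ho⟩,
    ⟨fun L => Ceven L / L, fun L => Codd L / L, fun L h3 => ?_, K, hK, ?_, ?_⟩,
    DeepNTK.exists_isEquivalent_eigenvalue_two hd⟩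
  · obtain ⟨h1, h2, h12, h4, h5⟩ := hL L h3
    have hL0 : (0 : ℝ) < L := by
      have : 0 < L := by omega
      exact_mod_cast this
    refine ⟨?_, div_pos h1 hL0, div_pos h2 hL0, fun h => h12 ((div_left_inj' hL0.ne').1 h), ?_, ?_⟩
    · obtain ⟨n, rfl⟩ := Nat.exists_eq_add_of_le' (show 1 ≤ L by omega)
      rw [DeepNTK.ntkKernel_apply_one]
      push_cast at hL0 ⊢
      exact div_self hL0.ne'
    · simp only [DeepNTK.eigenvalue_div_const, div_mul_eq_mul_div]
      exact h4.div IsEquivalent.refl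
    · simp only [DeepNTK.eigenvalue_div_const, div_mul_eq_mul_div]
      exact h5.div IsEquivalent.refl
  all_goals
    -- The equality also holds at `L = 0`, where division by zero gives `0`.
    have hr : (fun L : ℕ => K * (L : ℝ)) = fun L : ℕ => K * (L : ℝ) ^ 2 / L := by
      ext L
      rcases eq_or_ne (L : ℝ) 0 with h | h
      · simp [h]
      · field_simp
    rw [hr]
  · exact he.div IsEquivalent.refl
  · exact ho.div IsEquivalent.refl
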